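/- Let $m\ge 1$ and $a,b\ge 0$ be integers, and let $\rho$ be the natural representation of $gl(m,\mathbb R)$ on the space $\otimes^a_b\mathbb R^m=(\mathbb R^m)^{\otimes a}\otimes(\mathbb R^{m*})^{\otimes b}$ of $a$ times contravariant and $b$ times covariant tensors. Let $V\subset\otimes^a_b\mathbb R^m$ be a subspace stable under $\rho$. For $\lambda\in\mathbb R$, let $V_\lambda$ denote the space $V$ equipped with the representation $\rho_\lambda(A)=\rho(A)|_V-\lambda\,\mathrm{tr}(A)\,\mathrm{id}_V$ of $gl(m,\mathbb R)$, and let $H^p(gl(m,\mathbb R),V_\lambda)$, $p\ge 0$, be its Chevalley–Eilenberg cohomology spaces, $H(gl(m,\mathbb R),V_\lambda)=\bigoplus_{p\ge0}H^p(gl(m,\mathbb R),V_\lambda)$. If $\lambda\ne (a-b)/m$, then $H(gl(m,\mathbb R),V_\lambda)=0$, that is, $H^p(gl(m,\mathbb R),V_\lambda)=0$ for all $p\ge0$. If $\lambda=(a-b)/m$, then $H(gl(m,\mathbb R),V_\lambda)$ is isomorphic, as a graded real vector space, to $(\Lambda\, gl(m,\mathbb R)^*)_{gl\text{-inv}}\otimes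 V_{sl\text{-inv}}$; that is, for all $p\ge 0$, $$H^p(gl(m,\mathbb R),V_\lambda)\;\cong\;(\Lambda^p gl(m,\mathbb R)^*)_{gl\text{-inv}}\otimes V_{sl\text{-inv}} .$$ Here $(\Lambda^p gl(m,\mathbb R)^*)_{gl\text{-inv}}$ is the space of alternating $p$-linear forms on $gl(m,\mathbb R)$ that are invariant under the coadjoint action of $gl(m,\mathbb R)$, and $V_{sl\text{-inv}}=\{T\in V:\rho(A)T=0 \text{ for all } A\in sl(m,\mathbb R)\}$. -/

import Mathlib

open scoped TensorProduct

attribute [local instance 100] LieRing.ofAssociativeRing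

/-! ### Chevalley-Eilenberg cohomology of a real Lie algebra -/

namespace CE

section Aux

variable {L V : Type*} [LieRing L] [LieAlgebra ℝ L] [AddCommGroup V] [Module ℝ V]

/-- The value at `v = (v₀, …, vₙ)` of the Chevalley-Eilenberg coboundary of the `n`-cochain `c`
with values in the representation `ρ`:
`∑ⱼ (-1)ʲ ρ(vⱼ) c(…, v̂ⱼ, …) + ∑_{i<j} (-1)ʲ c(v₀, …, [vᵢ, vⱼ], …, v̂ⱼ, …, vₙ)`,
where, in the second sum, `[vᵢ, vⱼ]` stands at the place `i` of `vᵢ`, and `vⱼ` is omitted.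
(Moving `[vᵢ, vⱼ]` to the first place produces the sign `(-1)ⁱ`, which gives the equivalent form
`(-1)ⁱ⁺ʲ c([vᵢ, vⱼ], …, v̂ᵢ, …, v̂ⱼ, …)` of that term.) -/
def coboundaryFun (ρ : L →ₗ⁅ℝ⁆ Module.End ℝ V) {n : ℕ} (c : L [⋀^Fin n]→ₗ[ℝ] V)
    (v : Fin (n + 1) → L) : V :=
  (∑ j : Fin (n + 1), (-1 : ℝ) ^ (j : ℕ) • ρ (v j) (c (j.removeNth v))) +
    ∑ j : Fin (n + 1), ∑ i : Fin n, if i.castSucc < j then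
      (-1 : ℝ) ^ (j : ℕ) • c (Function.update (j.removeNth v) i ⁅v i.castSucc, v j⁆) else 0

/-- The natural action of an endomorphism `D` of `L` on alternating maps:
`(v₁, …, vₙ) ↦ ∑ᵢ c(v₁, …, D vᵢ, …, vₙ)`. -/
def derivAction (D : L →ₗ[ℝ] L) {n : ℕ} (c : L [⋀^Fin n]→ₗ[ℝ] V) : L [⋀^Fin n]→ₗ[ℝ] V where
  toFun v := ∑ i, c (Function.update v i (D (v i)))
  map_update_add' := by
    intro inst v k x y
    have : inst = instDecidableEqFin n := Subsingleton.elim _ _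
    subst this
    rw [← Finset.sum_add_distrib]
    refine Finset.sum_congr rfl fun i _ => ?_
    by_cases h : i = k
    · subst h; simp
    · simp [Function.update_of_ne h, Function.update_comm (Ne.symm h)]
  map_update_smul' := by
    intro inst v k r x
    have : inst = instDecidableEqFin n := Subsingleton.elim _ _
    subst this
    rw [Finset.smul_sum]
    refine Finset.sum_congr rfl fun i _ => ?_
    by_cases h : i = k
    · subst h; simp
    · simp [Function.update_of_ne h, Function.update_comm (Ne.symm h)]
  map_eq_zero_of_eq' := by
    intro v k l hkl hne
    rw [Fintype.sum_eq_add k l hne]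
    · have h := c.map_swap (Function.update v k (D (v k))) hne
      rw [← neg_eq_iff_add_eq_zero, ← h]
      congr 1
      ext t
      by_cases htk : t = k
      · subst htk; simp [Function.update_of_ne hne, hne.symm, hkl]
      · by_cases htl : t = l
        · subst htl; simp [hkl]
        · simp [Equiv.swap_apply_of_ne_of_ne htk htl, htk, htl]
    · rintro i ⟨hik, hil⟩
      exact c.map_eq_zero_of_eq _
        (by simp [Function.update_of_ne hik.symm, Function.update_of_ne hil.symm, hkl]) hne

lemma derivAction_apply (D : L →ₗ[ℝ] L) {n : ℕ} (c : L [⋀^Fin n]→ₗ[ℝ] V) (v : Fin n → L) :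
    derivAction D c v = ∑ i, c (Function.update v i (D (v i))) := rfl

lemma removeNth_update_swap {n : ℕ} (c : L [⋀^Fin n]→ₗ[ℝ] V) (v : Fin (n + 1) → L)
    (k i : Fin n) (hik : i ≤ k) (z : L) :
    (-1 : ℝ) ^ (i : ℕ) • c (Function.update (i.castSucc.removeNth v) k z) +
      (-1 : ℝ) ^ (k.succ : ℕ) • c (Function.update (k.succ.removeNth v) i z) = 0 := by
  have hlt : i.castSucc < k.succ := by
    rw [Fin.lt_def]; simp only [Fin.val_castSucc, Fin.val_succ]; omega
  have e1 : i.castSucc.succAbove k = k.succ :=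
    Fin.succAbove_of_le_castSucc _ _ (by rw [Fin.le_def]; simpa using hik)
  have e2 : k.succ.succAbove i = i.castSucc := Fin.succAbove_of_castSucc_lt _ _ hlt
  have h := c.neg_one_pow_smul_map_removeNth_add_eq_zero_of_eq
    (v := Function.update (Function.update v i.castSucc z) k.succ z)
    (i := i.castSucc) (j := k.succ)
    (by simp [Function.update_of_ne hlt.ne]) hlt.ne
  have f1 : i.castSucc.removeNth (Function.update (Function.update v i.castSucc z) k.succ z)
      = Function.update (i.castSucc.removeNth v) k z := by
    ext t
    by_cases ht : t = k
    · subst ht; simp [Fin.removeNth, e1]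
    · have : i.castSucc.succAbove t ≠ k.succ := by
        rw [← e1]; exact fun h => ht (Fin.succAbove_right_injective h)
      simp [Fin.removeNth, this, ht]
  have f2 : k.succ.removeNth (Function.update (Function.update v i.castSucc z) k.succ z)
      = Function.update (k.succ.removeNth v) i z := by
    ext t
    by_cases ht : t = i
    · subst ht; simp [Fin.removeNth, e2, hlt.ne]
    · have : k.succ.succAbove t ≠ i.castSucc := by
        rw [← e2]; exact fun h => ht (Fin.succAbove_right_injective h)
      simp [Fin.removeNth, this, ht]
  rw [f1, f2] at h
  have cast : ∀ (p : ℕ) (y : V), (-1 : ℝ) ^ p • y = (-1 : ℤ) ^ p • y := by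
    intro p y
    rw [← Int.cast_smul_eq_zsmul ℝ]; push_cast; rfl
  rw [cast, cast]
  exact_mod_cast h

lemma two_smul_bracket_sum {n : ℕ} (c : L [⋀^Fin n]→ₗ[ℝ] V) (v : Fin (n + 1) → L) :
    (∑ j : Fin (n + 1), (-1 : ℝ) ^ (j : ℕ) • ∑ i : Fin n,
      c (Function.update (j.removeNth v) i ⁅j.removeNth v i, v j⁆)) =
    (2 : ℝ) • ∑ j : Fin (n + 1), ∑ i : Fin n, if i.castSucc < j then
      (-1 : ℝ) ^ (j : ℕ) • c (Function.update (j.removeNth v) i ⁅v i.castSucc, v j⁆) else 0 := by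
  have split : ∀ (j : Fin (n + 1)) (i : Fin n),
      (-1 : ℝ) ^ (j : ℕ) • c (Function.update (j.removeNth v) i ⁅j.removeNth v i, v j⁆) =
      (if i.castSucc < j then
        (-1 : ℝ) ^ (j : ℕ) • c (Function.update (j.removeNth v) i ⁅v i.castSucc, v j⁆) else 0) +
      (if j ≤ i.castSucc then
        (-1 : ℝ) ^ (j : ℕ) • c (Function.update (j.removeNth v) i ⁅v i.succ, v j⁆) else 0) := by
    intro j i
    by_cases h : i.castSucc < j
    · have e : j.removeNth v i = v i.castSucc := by
        simp [Fin.removeNth, Fin.succAbove_of_castSucc_lt _ _ h]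
      rw [if_pos h, if_neg (not_le.2 h), add_zero, e]
    · have e : j.removeNth v i = v i.succ := by
        simp [Fin.removeNth, Fin.succAbove_of_le_castSucc _ _ (not_lt.1 h)]
      rw [if_neg h, if_pos (not_lt.1 h), zero_add, e]
  simp only [Finset.smul_sum (N := V) (s := (Finset.univ : Finset (Fin n))) (r := (-1 : ℝ) ^ _),
    split, Finset.sum_add_distrib]
  rw [two_smul]
  congr 1
  rw [Fin.sum_univ_castSucc, Fin.sum_univ_succ (n := n)]
  have l1 : ∀ i : Fin n, ¬ (Fin.last n ≤ i.castSucc) := fun i => not_le.2 (Fin.castSucc_lt_last i)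
  simp only [l1, if_false, Finset.sum_const_zero, add_zero, Fin.not_lt_zero, zero_add]
  rw [Finset.sum_comm]
  refine Finset.sum_congr rfl fun k _ => Finset.sum_congr rfl fun i _ => ?_
  by_cases h : i ≤ k
  · have h1 : i.castSucc ≤ k.castSucc := by simpa using h
    have h2 : i.castSucc < k.succ := by
      rw [Fin.lt_def]; simp only [Fin.val_castSucc, Fin.val_succ]; omega
    have h3 := removeNth_update_swap c v k i h ⁅v i.castSucc, v k.succ⁆
    rw [if_pos h1, if_pos h2, ← lie_skew (v k.succ) (v i.castSucc), AlternatingMap.map_update_neg,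
      smul_neg, Fin.val_castSucc]
    exact neg_eq_iff_add_eq_zero.2 h3
  · have h1 : ¬ i.castSucc ≤ k.castSucc := by simpa using h
    have h2 : ¬ i.castSucc < k.succ := by
      rw [Fin.lt_def]; simp only [Fin.val_castSucc, Fin.val_succ]; omega
    rw [if_neg h1, if_neg h2]

lemma exists_alternating_coboundaryFun (ρ : L →ₗ⁅ℝ⁆ Module.End ℝ V) {n : ℕ}
    (c : L [⋀^Fin n]→ₗ[ℝ] V) :
    ∃ ω : L [⋀^Fin (n + 1)]→ₗ[ℝ] V, ∀ v, ω v = coboundaryFun ρ c v := by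
  let f : L →ₗ[ℝ] L [⋀^Fin n]→ₗ[ℝ] V :=
    { toFun := fun x => (ρ x).compAlternatingMap c
      map_add' := fun x y => by ext; simp
      map_smul' := fun r x => by ext; simp }
  let g : L →ₗ[ℝ] L [⋀^Fin n]→ₗ[ℝ] V :=
    { toFun := fun x => derivAction (-(LieAlgebra.ad ℝ L x : L →ₗ[ℝ] L)) c
      map_add' := fun x y => by
        ext u
        simp [derivAction_apply, Finset.sum_add_distrib, add_comm]
      map_smul' := fun r x => by
        ext u
        simp [derivAction_apply, Finset.smul_sum, ← smul_neg] }
  refine ⟨AlternatingMap.alternatizeUncurryFin f +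
    (2 : ℝ)⁻¹ • AlternatingMap.alternatizeUncurryFin g, fun v => ?_⟩
  have cast : ∀ (p : ℕ) (y : V), (-1 : ℤ) ^ p • y = (-1 : ℝ) ^ p • y := by
    intro p y
    rw [← Int.cast_smul_eq_zsmul ℝ]; push_cast; rfl
  have hg : AlternatingMap.alternatizeUncurryFin g v =
      ∑ j : Fin (n + 1), (-1 : ℝ) ^ (j : ℕ) • ∑ i : Fin n,
        c (Function.update (j.removeNth v) i ⁅j.removeNth v i, v j⁆) := by
    rw [AlternatingMap.alternatizeUncurryFin_apply]
    refine Finset.sum_congr rfl fun j _ => ?_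
    have : g (v j) (j.removeNth v) = ∑ i : Fin n,
        c (Function.update (j.removeNth v) i ⁅j.removeNth v i, v j⁆) := by
      simp only [g, LinearMap.coe_mk, AddHom.coe_mk, derivAction_apply]
      refine Finset.sum_congr rfl fun i _ => ?_
      rw [LinearMap.neg_apply, LieAlgebra.ad_apply, lie_skew]
    rw [this]
    exact_mod_cast cast j _
  rw [AlternatingMap.add_apply, AlternatingMap.smul_apply, hg, two_smul_bracket_sum, smul_smul,
    inv_mul_cancel₀ (two_ne_zero), one_smul, AlternatingMap.alternatizeUncurryFin_apply,
    coboundaryFun]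
  congr 1
  refine Finset.sum_congr rfl fun j _ => ?_
  have : f (v j) (j.removeNth v) = ρ (v j) (c (j.removeNth v)) := rfl
  rw [this]
  exact_mod_cast cast j _

end Aux

section Cohomology

variable {L V : Type*} [LieRing L] [LieAlgebra ℝ L] [AddCommGroup V] [Module ℝ V]

/-- The Chevalley-Eilenberg coboundary operator `Λⁿ(L, V) → Λⁿ⁺¹(L, V)` of the representation
`ρ` of `L` on `V`, where `Λⁿ(L, V)` is the space of alternating `n`-linear maps from `L` to `V`. -/
def coboundary (ρ : L →ₗ⁅ℝ⁆ Module.End ℝ V) (n : ℕ) :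
    (L [⋀^Fin n]→ₗ[ℝ] V) →ₗ[ℝ] (L [⋀^Fin (n + 1)]→ₗ[ℝ] V) where
  toFun c :=
    { toFun := coboundaryFun ρ c
      map_update_add' := by
        obtain ⟨ω, hω⟩ := exists_alternating_coboundaryFun ρ c
        intro _ v i x y
        simp only [← hω, ω.map_update_add]
      map_update_smul' := by
        obtain ⟨ω, hω⟩ := exists_alternating_coboundaryFun ρ c
        intro _ v i r x
        simp only [← hω, ω.map_update_smul]
      map_eq_zero_of_eq' := by
        obtain ⟨ω, hω⟩ := exists_alternating_coboundaryFun ρ c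
        intro v i j h hij
        simp only [← hω, ω.map_eq_zero_of_eq v h hij] }
  map_add' c c' := by
    ext v
    change coboundaryFun ρ (c + c') v = coboundaryFun ρ c v + coboundaryFun ρ c' v
    simp only [coboundaryFun, AlternatingMap.add_apply, map_add, smul_add, ite_add_zero,
      Finset.sum_add_distrib]
    abel
  map_smul' r c := by
    ext v
    change coboundaryFun ρ (r • c) v = r • coboundaryFun ρ c v
    simp only [coboundaryFun, AlternatingMap.smul_apply, map_smul, smul_add, Finset.smul_sum,
      smul_ite, smul_zero, smul_comm r]

/-- The space of `n`-cocycles. -/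
def cocycles (ρ : L →ₗ⁅ℝ⁆ Module.End ℝ V) (n : ℕ) : Submodule ℝ (L [⋀^Fin n]→ₗ[ℝ] V) :=
  LinearMap.ker (coboundary ρ n)

/-- The space of `n`-coboundaries. -/
def coboundaries (ρ : L →ₗ⁅ℝ⁆ Module.End ℝ V) : (n : ℕ) → Submodule ℝ (L [⋀^Fin n]→ₗ[ℝ] V)
  | 0 => ⊥
  | n + 1 => LinearMap.range (coboundary ρ n)

/-- The `n`-th Chevalley-Eilenberg cohomology space `Hⁿ(L, V)` of the representation `ρ` of `L`
on `V`: the cocycles modulo the coboundaries. -/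
abbrev Cohomology (ρ : L →ₗ⁅ℝ⁆ Module.End ℝ V) (n : ℕ) : Type _ :=
  cocycles ρ n ⧸ (coboundaries ρ n).submoduleOf (cocycles ρ n)

/-- The invariant vectors of a representation: those annihilated by every element of `L`. -/
def invariants (ρ : L →ₗ⁅ℝ⁆ Module.End ℝ V) : Submodule ℝ V where
  carrier := {w | ∀ x, ρ x w = 0}
  add_mem' h h' x := by rw [map_add, h x, h' x, add_zero]
  zero_mem' x := map_zero _
  smul_mem' r w h x := by rw [map_smul, h x, smul_zero]

variable (L) in
/-- The space `(Λⁿ L*)_inv` of alternating `n`-linear forms on `L` that are invariant under the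
(co)adjoint action: `∑ᵢ c(x₁, …, [x, xᵢ], …, xₙ) = 0` for all `x, x₁, …, xₙ`. -/
def invariantForms (n : ℕ) : Submodule ℝ (L [⋀^Fin n]→ₗ[ℝ] ℝ) where
  carrier := {c | ∀ (x : L) (v : Fin n → L), ∑ i, c (Function.update v i ⁅x, v i⁆) = 0}
  add_mem' h h' x v := by
    simp only [AlternatingMap.add_apply, Finset.sum_add_distrib, h x v, h' x v, add_zero]
  zero_mem' x v := by simp
  smul_mem' r c h x v := by
    simp only [AlternatingMap.smul_apply, ← Finset.smul_sum, h x v, smul_zero]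

end Cohomology

/-! ### Constructions on representations -/

section Rep

variable {L V W : Type*} [LieRing L] [LieAlgebra ℝ L] [AddCommGroup V] [Module ℝ V]
  [AddCommGroup W] [Module ℝ W]

/-- The dual representation: `⟨x · ξ, v⟩ = -⟨ξ, x · v⟩`. -/
def dualRep (ρ : L →ₗ⁅ℝ⁆ Module.End ℝ V) : L →ₗ⁅ℝ⁆ Module.End ℝ (Module.Dual ℝ V) where
  toFun x := -(ρ x).dualMap
  map_add' x y := by ext; simp [add_comm]
  map_smul' r x := by ext; simp
  map_lie' := by intro x y; ext; simp [LieRing.of_associative_ring_bracket]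

/-- The tensor product of two representations: `x · (v ⊗ w) = (x · v) ⊗ w + v ⊗ (x · w)`. -/
noncomputable def tensorRep (ρ : L →ₗ⁅ℝ⁆ Module.End ℝ V) (σ : L →ₗ⁅ℝ⁆ Module.End ℝ W) :
    L →ₗ⁅ℝ⁆ Module.End ℝ (V ⊗[ℝ] W) where
  toFun x := (ρ x).rTensor W + (σ x).lTensor V
  map_add' x y := by ext; simp; abel
  map_smul' r x := by ext; simp [TensorProduct.smul_tmul']
  map_lie' := by
    intro x y
    ext
    simp [LieRing.of_associative_ring_bracket]
    abel

/-- The `n`-th tensor power `V^{⊗ n}` of a real vector space. -/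
def TensorPow (V : Type*) [AddCommGroup V] [Module ℝ V] (n : ℕ) : Type _ :=
  ⨂[ℝ] _ : Fin n, V

noncomputable instance (n : ℕ) : AddCommGroup (TensorPow V n) :=
  inferInstanceAs (AddCommGroup (⨂[ℝ] _ : Fin n, V))

noncomputable instance (n : ℕ) : Module ℝ (TensorPow V n) :=
  inferInstanceAs (Module ℝ (⨂[ℝ] _ : Fin n, V))

/-- The endomorphism `v₁ ⊗ ⋯ ⊗ vₙ ↦ f₁ v₁ ⊗ ⋯ ⊗ fₙ vₙ` of `V^{⊗ n}`. -/
noncomputable def tensorPowMap (n : ℕ) :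
    (Fin n → Module.End ℝ V) →* Module.End ℝ (TensorPow V n) :=
  PiTensorProduct.mapMonoidHom (R := ℝ) (s := fun _ : Fin n => V)

lemma tensorPowMap_update_add {n : ℕ} (F : Fin n → Module.End ℝ V) (i : Fin n)
    (f g : Module.End ℝ V) :
    tensorPowMap n (Function.update F i (f + g)) =
      tensorPowMap n (Function.update F i f) + tensorPowMap n (Function.update F i g) :=
  PiTensorProduct.map_update_add F i f g

lemma tensorPowMap_update_smul {n : ℕ} (F : Fin n → Module.End ℝ V) (i : Fin n)
    (r : ℝ) (f : Module.End ℝ V) :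
    tensorPowMap n (Function.update F i (r • f)) = r • tensorPowMap n (Function.update F i f) :=
  PiTensorProduct.map_update_smul F i r f

/-- The `n`-th tensor power of a representation:
`x · (v₁ ⊗ ⋯ ⊗ vₙ) = ∑ᵢ v₁ ⊗ ⋯ ⊗ (x · vᵢ) ⊗ ⋯ ⊗ vₙ` (zero for `n = 0`). -/
noncomputable def tensorPowerRep (ρ : L →ₗ⁅ℝ⁆ Module.End ℝ V) (n : ℕ) :
    L →ₗ⁅ℝ⁆ Module.End ℝ (TensorPow V n) where
  toFun x := ∑ i : Fin n, tensorPowMap n (Function.update 1 i (ρ x))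
  map_add' x y := by
    simp only [map_add, tensorPowMap_update_add, Finset.sum_add_distrib]
  map_smul' r x := by
    simp only [map_smul, tensorPowMap_update_smul, Finset.smul_sum, RingHom.id_apply]
  map_lie' := by
    intro x y
    have hs : ∀ (i : Fin n) (f g : Module.End ℝ V),
        tensorPowMap n (Function.update 1 i (f - g)) =
          tensorPowMap n (Function.update 1 i f) - tensorPowMap n (Function.update 1 i g) := by
      intro i f g
      rw [eq_sub_iff_add_eq, ← tensorPowMap_update_add, sub_add_cancel]
    have hm : ∀ (i : Fin n) (f g : Module.End ℝ V),
        tensorPowMap n (Function.update 1 i (f * g)) =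
          tensorPowMap n (Function.update 1 i f) * tensorPowMap n (Function.update 1 i g) := by
      intro i f g
      rw [← map_mul]
      exact congrArg _ (Pi.mulSingle_mul (f := fun _ : Fin n => Module.End ℝ V) i f g)
    have hc : ∀ (i j : Fin n) (f g : Module.End ℝ V), i ≠ j →
        tensorPowMap n (Function.update 1 i f) * tensorPowMap n (Function.update 1 j g) =
          tensorPowMap n (Function.update 1 j g) * tensorPowMap n (Function.update 1 i f) := by
      intro i j f g hij
      rw [← map_mul, ← map_mul]
      exact congrArg _ (Pi.mulSingle_commute (f := fun _ : Fin n => Module.End ℝ V) hij f g).eq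
    have hρ : ρ ⁅x, y⁆ = ρ x * ρ y - ρ y * ρ x := ρ.map_lie x y
    rw [LieRing.of_associative_ring_bracket, Finset.sum_mul_sum, Finset.sum_mul_sum,
      Finset.sum_comm (f := fun i j => tensorPowMap n (Function.update 1 i (ρ y)) *
        tensorPowMap n (Function.update 1 j (ρ x))), ← Finset.sum_sub_distrib]
    refine Finset.sum_congr rfl fun i _ => ?_
    rw [← Finset.sum_sub_distrib, Finset.sum_eq_single i, hρ, hs, hm, hm]
    · intro j _ hj
      rw [hc i j _ _ hj.symm, sub_self]
    · simp

/-- The restriction of a representation to a stable subspace. -/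
def subRep (ρ : L →ₗ⁅ℝ⁆ Module.End ℝ V) (U : Submodule ℝ V) (hU : ∀ x, ∀ u ∈ U, ρ x u ∈ U) :
    L →ₗ⁅ℝ⁆ Module.End ℝ U where
  toFun x := (ρ x).restrict (hU x)
  map_add' x y := by ext; simp
  map_smul' r x := by ext; simp
  map_lie' := by intro x y; ext; simp [LieRing.of_associative_ring_bracket]

end Rep

/-! ### The Lie algebra `gl(m, ℝ)` and its representations on tensors -/

section General

variable {V : Type*} [AddCommGroup V] [Module ℝ V]

/-- The deformed representation `ρ_lam : A ↦ ρ(A) - lam tr(A) id` of `gl(m, ℝ)`. -/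
def twist {m : ℕ} (ρ : Matrix (Fin m) (Fin m) ℝ →ₗ⁅ℝ⁆ Module.End ℝ V) (lam : ℝ) :
    Matrix (Fin m) (Fin m) ℝ →ₗ⁅ℝ⁆ Module.End ℝ V where
  toFun A := ρ A - (lam * A.trace) • LinearMap.id
  map_add' A B := by ext; simp [mul_add, add_smul]; abel
  map_smul' r A := by ext; simp [smul_sub, smul_smul, mul_left_comm]
  map_lie' := by
    intro A B
    have hρ : ρ ⁅A, B⁆ = ρ A * ρ B - ρ B * ρ A := ρ.map_lie A B
    rw [hρ]
    ext
    simp only [LieRing.of_associative_ring_bracket, Matrix.trace_sub,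
      Matrix.trace_mul_comm A B, sub_self, mul_zero, zero_smul, sub_zero, LinearMap.sub_apply,
      Module.End.mul_apply, LinearMap.smul_apply, LinearMap.id_apply, map_sub, map_smul, smul_sub,
      smul_smul, mul_comm (lam * B.trace)]
    abel

/-- The restriction of a representation of `gl(m, ℝ)` to `sl(m, ℝ)`. -/
def restrictSl {m : ℕ} (ρ : Matrix (Fin m) (Fin m) ℝ →ₗ⁅ℝ⁆ Module.End ℝ V) :
    LieAlgebra.SpecialLinear.sl (Fin m) ℝ →ₗ⁅ℝ⁆ Module.End ℝ V :=
  ρ.comp (LieAlgebra.SpecialLinear.sl (Fin m) ℝ).incl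

/-- The natural representation of `gl(m, ℝ)` on `ℝᵐ`: multiplication of column vectors. -/
def vectorRep (m : ℕ) : Matrix (Fin m) (Fin m) ℝ →ₗ⁅ℝ⁆ Module.End ℝ (Fin m → ℝ) where
  toFun A := Matrix.mulVecLin A
  map_add' A B := Matrix.mulVecLin_add A B
  map_smul' r A := by ext; simp
  map_lie' := by
    intro A B
    ext
    simp [LieRing.of_associative_ring_bracket]

/-- The space `⊗ᵃ_b ℝᵐ` of `a` times contravariant and `b` times covariant tensors:
`(ℝᵐ)^{⊗ a} ⊗ (ℝᵐ*)^{⊗ b}`. -/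
abbrev TensorSpace (m a b : ℕ) : Type :=
  TensorPow (Fin m → ℝ) a ⊗[ℝ] TensorPow (Module.Dual ℝ (Fin m → ℝ)) b

/-- The natural representation of `gl(m, ℝ)` on `⊗ᵃ_b ℝᵐ`. -/
noncomputable def naturalRep (m a b : ℕ) :
    Matrix (Fin m) (Fin m) ℝ →ₗ⁅ℝ⁆ Module.End ℝ (TensorSpace m a b) :=
  tensorRep (tensorPowerRep (vectorRep m) a) (tensorPowerRep (dualRep (vectorRep m)) b)

end General

end CE

namespace CE

/-! ### Cartan calculus on cochains -/

section Calculus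

variable {L V : Type*} [LieRing L] [LieAlgebra ℝ L] [AddCommGroup V] [Module ℝ V]

/-! The identity matrix is central and acts on `V_lam` by the scalar `a - b - lam * m`, so its Lie
derivative on cochains is this same scalar. By Cartan's formula a Lie derivative maps cocycles to
coboundaries. If the scalar is nonzero, every cocycle is therefore a coboundary
(`subsingleton_cohomology_of_central`).

If `lam = (a - b) / m`, the argument is Hodge theory. The inner product on tensors in which the
standard basis is orthonormal makes the action of the transpose of `A` adjoint to that of `A`; this
survives restriction to `V` and twisting by the trace. With an orthonormal basis `e i` of matrices
and the transposition `τ`, the operator `Δ = ∑ θ(e i) θ(τ (e i)) + ∑ ρ(e i) ρ(τ (e i))` on cochains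
has the form `∑ T* T`. It follows that the cochains split into its kernel and its range, and that
its kernel is the common kernel of all `θ(x)` and all `ρ(x)`, namely the invariant cochains with
invariant values (`ker_laplacian`).

Both halves of `Δ` commute with the coboundary and map cocycles to coboundaries: the first by
Cartan's formula, the second by a contraction homotopy that rests on the invariance of `∑ e i ⊗ τ (e
i)` (`coboundary_casimirHomotopy`). Hence the kernel of `Δ` represents the cohomology
(`exists_equiv_ker_of_isCompl`). A basis of the invariants of `V_lam` turns this kernel into a
tensor product, and these invariants are those of `sl`, since the identity matrix acts by zero
(`invariants_twist`). -/

lemma coboundary_apply (ρ : L →ₗ⁅ℝ⁆ Module.End ℝ V) {n : ℕ} (c : L [⋀^Fin n]→ₗ[ℝ] V)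
    (v : Fin (n + 1) → L) : coboundary ρ n c v = coboundaryFun ρ c v := rfl

/-- Alternating maps in `n + 1` variables agree if all their partial evaluations agree. -/
lemma ext_curryLeft {n : ℕ} {c c' : L [⋀^Fin (n + 1)]→ₗ[ℝ] V}
    (h : ∀ x, c.curryLeft x = c'.curryLeft x) : c = c' := by
  ext v
  have := congrArg (fun g => g (Fin.tail v)) (h (v 0))
  simpa [Matrix.vecCons] using this

/-- The Lie derivative of cochains. -/
def lieDeriv (ρ : L →ₗ⁅ℝ⁆ Module.End ℝ V) (n : ℕ) :
    L →ₗ[ℝ] Module.End ℝ (L [⋀^Fin n]→ₗ[ℝ] V) where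
  toFun x :=
    { toFun := fun c => (ρ x).compAlternatingMap c - derivAction (LieAlgebra.ad ℝ L x) c
      map_add' := fun c c' => by
        ext v
        simp only [AlternatingMap.sub_apply, LinearMap.compAlternatingMap_apply,
          AlternatingMap.add_apply, derivAction_apply, map_add, Finset.sum_add_distrib]
        abel
      map_smul' := fun r c => by
        ext v
        simp [derivAction_apply, Finset.smul_sum, smul_sub] }
  map_add' x y := by
    ext c v
    simp [derivAction_apply, Finset.sum_add_distrib]
    abel
  map_smul' r x := by
    ext c v
    simp [derivAction_apply, Finset.smul_sum, smul_sub]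

lemma lieDeriv_apply (ρ : L →ₗ⁅ℝ⁆ Module.End ℝ V) {n : ℕ} (x : L) (c : L [⋀^Fin n]→ₗ[ℝ] V)
    (v : Fin n → L) :
    lieDeriv ρ n x c v = ρ x (c v) - ∑ i, c (Function.update v i ⁅x, v i⁆) := rfl

/-- The commutation rule `[θ_x, i_y] = i_[x,y]`, where `i_y` is partial evaluation. With Cartan's
formula it reduces the identities below to inductions on the degree. -/
lemma curryLeft_lieDeriv (ρ : L →ₗ⁅ℝ⁆ Module.End ℝ V) {n : ℕ} (x y : L)
    (c : L [⋀^Fin (n + 1)]→ₗ[ℝ] V) :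
    (lieDeriv ρ (n + 1) x c).curryLeft y =
      lieDeriv ρ n x (c.curryLeft y) - c.curryLeft ⁅x, y⁆ := by
  ext v
  simp only [AlternatingMap.curryLeft_apply_apply, AlternatingMap.sub_apply, lieDeriv_apply,
    Fin.sum_univ_succ, Matrix.vecCons, Fin.cons_zero, Fin.cons_succ, Fin.update_cons_zero,
    Fin.cons_update]
  abel

lemma lieDeriv_zero_apply (ρ : L →ₗ⁅ℝ⁆ Module.End ℝ V) (x : L) (c : L [⋀^Fin 0]→ₗ[ℝ] V) :
    lieDeriv ρ 0 x c = (ρ x).compAlternatingMap c := by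
  ext v
  simp [lieDeriv_apply]

lemma curryLeft_coboundary_zero (ρ : L →ₗ⁅ℝ⁆ Module.End ℝ V) (x : L)
    (c : L [⋀^Fin 0]→ₗ[ℝ] V) : (coboundary ρ 0 c).curryLeft x = lieDeriv ρ 0 x c := by
  ext v
  simp [lieDeriv_apply, coboundary_apply, coboundaryFun, Subsingleton.elim _ v]

lemma removeNth_succ_cons {α : Type*} {n : ℕ} (x : α) (v : Fin (n + 1) → α) (j : Fin (n + 1)) :
    j.succ.removeNth (Fin.cons x v : Fin (n + 2) → α) = Fin.cons x (j.removeNth v) := by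
  ext t
  refine Fin.cases ?_ (fun t => ?_) t <;> simp [Fin.removeNth]

lemma map_cons_removeNth {n : ℕ} (c : L [⋀^Fin (n + 1)]→ₗ[ℝ] V) (v : Fin (n + 1) → L)
    (j : Fin (n + 1)) (z : L) :
    (-1 : ℝ) ^ (j : ℕ) • c (Fin.cons z (j.removeNth v)) = c (Function.update v j z) := by
  have h := c.map_insertNth j z (j.removeNth v)
  rw [Fin.insertNth_removeNth] at h
  rw [h, ← Int.cast_smul_eq_zsmul ℝ]
  push_cast
  rfl

/-- Cartan's formula. -/
lemma curryLeft_coboundary (ρ : L →ₗ⁅ℝ⁆ Module.End ℝ V) {n : ℕ} (x : L)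
    (c : L [⋀^Fin (n + 1)]→ₗ[ℝ] V) :
    (coboundary ρ (n + 1) c).curryLeft x =
      lieDeriv ρ (n + 1) x c - coboundary ρ n (c.curryLeft x) := by
  ext v
  simp only [AlternatingMap.curryLeft_apply_apply, AlternatingMap.sub_apply, lieDeriv_apply,
    coboundary_apply, coboundaryFun, Matrix.vecCons]
  -- These bracket terms involve `x`. Moving the bracket from the first place to place `j` absorbs
  -- the sign and gives the adjoint part of the Lie derivative.
  have key : ∀ j : Fin (n + 1), (-1 : ℝ) ^ (j : ℕ) • c (Fin.cons ⁅x, v j⁆ (j.removeNth v)) =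
      c (Function.update v j ⁅x, v j⁆) := fun j => map_cons_removeNth c v j _
  rw [Fin.sum_univ_succ, Fin.sum_univ_succ (f := fun j : Fin (n + 2) => ∑ i : Fin (n + 1), _)]
  simp only [Fin.sum_univ_succ (n := n) (f := fun i : Fin (n + 1) => ite _ _ _)]
  simp only [Fin.val_zero, pow_zero, one_smul, Fin.cons_zero, Fin.cons_succ,
    Fin.not_lt_zero, if_false, Finset.sum_const_zero, zero_add, add_zero, removeNth_succ_cons,
    Fin.castSucc_zero, Fin.succ_pos, if_true, Fin.update_cons_zero, ← Fin.cons_update,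
    ← Fin.succ_castSucc, Fin.succ_lt_succ_iff, Fin.val_succ, pow_succ, mul_neg_one, neg_smul,
    key, Finset.sum_add_distrib, Finset.sum_neg_distrib]
  have h0 : (0 : Fin (n + 2)).removeNth (Fin.cons x v : Fin (n + 2) → L) = v := by
    ext t; simp [Fin.removeNth]
  rw [h0]
  have hneg : ∀ (p : Prop) [Decidable p] (w : V), (if p then -w else 0) = -(if p then w else 0) := by
    intro p _ w; split_ifs <;> simp
  simp only [hneg, Finset.sum_neg_distrib]
  abel

lemma curryLeft_comp (f : Module.End ℝ V) {n : ℕ} (c : L [⋀^Fin (n + 1)]→ₗ[ℝ] V) (x : L) :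
    (f.compAlternatingMap c).curryLeft x = f.compAlternatingMap (c.curryLeft x) := rfl

lemma curryLeft_sub {n : ℕ} (c c' : L [⋀^Fin (n + 1)]→ₗ[ℝ] V) (x : L) :
    (c - c').curryLeft x = c.curryLeft x - c'.curryLeft x := rfl

/-- Polarization of `i_z i_z = 0` at `z = x + y`. -/
lemma curryLeft_skew {n : ℕ} (c : L [⋀^Fin (n + 2)]→ₗ[ℝ] V) (x y : L) :
    (c.curryLeft x).curryLeft y = -(c.curryLeft y).curryLeft x := by
  have h := AlternatingMap.curryLeft_same c (x + y)
  simp only [map_add, AlternatingMap.curryLeft_add, LinearMap.add_apply,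
    AlternatingMap.curryLeft_same, zero_add, add_zero] at h
  exact eq_neg_of_add_eq_zero_right h

lemma lieDeriv_lie (ρ : L →ₗ⁅ℝ⁆ Module.End ℝ V) {n : ℕ} (x y : L) (c : L [⋀^Fin n]→ₗ[ℝ] V) :
    lieDeriv ρ n ⁅x, y⁆ c =
      lieDeriv ρ n x (lieDeriv ρ n y c) - lieDeriv ρ n y (lieDeriv ρ n x c) := by
  induction n with
  | zero =>
    simp only [lieDeriv_zero_apply]
    ext v
    have hρ : ρ ⁅x, y⁆ = ρ x * ρ y - ρ y * ρ x := ρ.map_lie x y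
    simp [hρ]
  | succ n ih =>
    refine ext_curryLeft fun z => ?_
    simp only [curryLeft_sub, curryLeft_lieDeriv, ih, map_sub, lie_lie]
    abel

lemma coboundary_lieDeriv (ρ : L →ₗ⁅ℝ⁆ Module.End ℝ V) {n : ℕ} (x : L)
    (c : L [⋀^Fin n]→ₗ[ℝ] V) :
    coboundary ρ n (lieDeriv ρ n x c) = lieDeriv ρ (n + 1) x (coboundary ρ n c) := by
  induction n with
  | zero =>
    refine ext_curryLeft fun y => ?_
    simp only [curryLeft_lieDeriv, curryLeft_coboundary_zero, lieDeriv_lie]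
    abel
  | succ n ih =>
    refine ext_curryLeft fun y => ?_
    simp only [curryLeft_lieDeriv, curryLeft_coboundary, lieDeriv_lie, map_sub, ih]
    abel

lemma coboundary_coboundary (ρ : L →ₗ⁅ℝ⁆ Module.End ℝ V) {n : ℕ} (c : L [⋀^Fin n]→ₗ[ℝ] V) :
    coboundary ρ (n + 1) (coboundary ρ n c) = 0 := by
  induction n with
  | zero =>
    refine ext_curryLeft fun y => ?_
    simp only [curryLeft_coboundary, curryLeft_coboundary_zero, coboundary_lieDeriv]
    simp
  | succ n ih =>
    refine ext_curryLeft fun y => ?_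
    simp only [curryLeft_coboundary, coboundary_lieDeriv, map_sub, ih]
    simp

end Calculus

/-! ### The Casimir operator is null-homotopic -/

section Casimir

variable {L V ι : Type*} [LieRing L] [LieAlgebra ℝ L] [AddCommGroup V] [Module ℝ V] [Fintype ι]

/-- The contraction `c ↦ ∑ᵢ ρ(eᵢ) c(e'ᵢ, …)`. -/
def casimirHomotopy (ρ : L →ₗ⁅ℝ⁆ Module.End ℝ V) (e e' : ι → L) (n : ℕ)
    (c : L [⋀^Fin (n + 1)]→ₗ[ℝ] V) : L [⋀^Fin n]→ₗ[ℝ] V :=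
  ∑ i, (ρ (e i)).compAlternatingMap (c.curryLeft (e' i))

/-- The Casimir operator `∑ᵢ ρ(eᵢ) ρ(e'ᵢ)` on the values of cochains. -/
def casimir (ρ : L →ₗ⁅ℝ⁆ Module.End ℝ V) (e e' : ι → L) (n : ℕ)
    (c : L [⋀^Fin n]→ₗ[ℝ] V) : L [⋀^Fin n]→ₗ[ℝ] V :=
  ∑ i, (ρ (e i)).compAlternatingMap ((ρ (e' i)).compAlternatingMap c)

variable (ρ : L →ₗ⁅ℝ⁆ Module.End ℝ V) (e e' : ι → L)

lemma curryLeft_sum {κ : Type*} (s : Finset κ) {n : ℕ} (c : κ → L [⋀^Fin (n + 1)]→ₗ[ℝ] V)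
    (x : L) : (∑ k ∈ s, c k).curryLeft x = ∑ k ∈ s, (c k).curryLeft x := by
  have h := congrArg (fun g => g x)
    (map_sum (AlternatingMap.curryLeftLinearMap (R := ℝ) (M := L) (N := V) (n := n)) c s)
  exact h.trans (LinearMap.sum_apply _ _ _)

lemma comp_sub (f : Module.End ℝ V) {n : ℕ} (c c' : L [⋀^Fin n]→ₗ[ℝ] V) :
    f.compAlternatingMap (c - c') = f.compAlternatingMap c - f.compAlternatingMap c' := by
  ext v; simp

lemma comp_neg (f : Module.End ℝ V) {n : ℕ} (c : L [⋀^Fin n]→ₗ[ℝ] V) :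
    f.compAlternatingMap (-c) = -f.compAlternatingMap c := by
  ext v; simp

lemma lieDeriv_comp {n : ℕ} (x y : L) (c : L [⋀^Fin n]→ₗ[ℝ] V) :
    lieDeriv ρ n x ((ρ y).compAlternatingMap c) =
      (ρ ⁅x, y⁆).compAlternatingMap c + (ρ y).compAlternatingMap (lieDeriv ρ n x c) := by
  ext v
  have hρ : ρ ⁅x, y⁆ = ρ x * ρ y - ρ y * ρ x := ρ.map_lie x y
  simp [lieDeriv_apply, hρ]

lemma casimirHomotopy_sub {n : ℕ} (c c' : L [⋀^Fin (n + 1)]→ₗ[ℝ] V) :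
    casimirHomotopy ρ e e' n (c - c') =
      casimirHomotopy ρ e e' n c - casimirHomotopy ρ e e' n c' := by
  simp only [casimirHomotopy, curryLeft_sub, comp_sub, Finset.sum_sub_distrib]

lemma curryLeft_casimirHomotopy {n : ℕ} (c : L [⋀^Fin (n + 2)]→ₗ[ℝ] V) (x : L) :
    (casimirHomotopy ρ e e' (n + 1) c).curryLeft x =
      -casimirHomotopy ρ e e' n (c.curryLeft x) := by
  simp only [casimirHomotopy, curryLeft_sum, curryLeft_comp, ← Finset.sum_neg_distrib, ← comp_neg]
  exact Finset.sum_congr rfl fun i _ => congrArg _ (curryLeft_skew c _ _)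

lemma curryLeft_casimir {n : ℕ} (c : L [⋀^Fin (n + 1)]→ₗ[ℝ] V) (x : L) :
    (casimir ρ e e' (n + 1) c).curryLeft x = casimir ρ e e' n (c.curryLeft x) := by
  simp only [casimir, curryLeft_sum, curryLeft_comp]

/-- The bilinear map `(y, z) ↦ ρ(y) c(z, …)`. -/
def repCurry {n : ℕ} (c : L [⋀^Fin (n + 1)]→ₗ[ℝ] V) : L →ₗ[ℝ] L →ₗ[ℝ] L [⋀^Fin n]→ₗ[ℝ] V :=
  LinearMap.mk₂ ℝ (fun y z => (ρ y).compAlternatingMap (c.curryLeft z))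
    (fun _ _ _ => by ext; simp) (fun _ _ _ => by ext; simp) (fun _ _ _ => by ext; simp)
    (fun _ _ _ => by ext; simp)

variable {e e'}

/-- The defect of commutation is the image of the invariance relation `he x` under the linear map
induced by `repCurry`. -/
lemma lieDeriv_casimirHomotopy
    (he : ∀ x : L, ∑ i, (⁅x, e i⁆ ⊗ₜ[ℝ] e' i + e i ⊗ₜ[ℝ] ⁅x, e' i⁆) = 0)
    {n : ℕ} (x : L) (c : L [⋀^Fin (n + 1)]→ₗ[ℝ] V) :
    lieDeriv ρ n x (casimirHomotopy ρ e e' n c) =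
      casimirHomotopy ρ e e' n (lieDeriv ρ (n + 1) x c) := by
  have h := congrArg (TensorProduct.lift (repCurry ρ c)) (he x)
  simp only [map_sum, map_add, TensorProduct.lift.tmul, map_zero, repCurry,
    LinearMap.mk₂_apply] at h
  rw [← sub_eq_zero, ← h]
  simp only [casimirHomotopy, map_sum, lieDeriv_comp, curryLeft_lieDeriv, comp_sub,
    ← Finset.sum_sub_distrib]
  refine Finset.sum_congr rfl fun i _ => ?_
  abel

lemma casimirHomotopy_coboundary_zero (c : L [⋀^Fin 0]→ₗ[ℝ] V) :
    casimirHomotopy ρ e e' 0 (coboundary ρ 0 c) = casimir ρ e e' 0 c := by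
  simp only [casimirHomotopy, casimir, curryLeft_coboundary_zero, lieDeriv_zero_apply]

/-- Induction on the degree by partial evaluation `i_x`. The contraction `h` anticommutes with `i_x`
and commutes with `θ_x`, so in `i_x (d h + h d)` the Lie derivatives cancel and `(d h + h d) i_x`
remains. -/
lemma coboundary_casimirHomotopy
    (he : ∀ x : L, ∑ i, (⁅x, e i⁆ ⊗ₜ[ℝ] e' i + e i ⊗ₜ[ℝ] ⁅x, e' i⁆) = 0)
    {n : ℕ} (c : L [⋀^Fin (n + 1)]→ₗ[ℝ] V) :
    coboundary ρ n (casimirHomotopy ρ e e' n c) +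
      casimirHomotopy ρ e e' (n + 1) (coboundary ρ (n + 1) c) = casimir ρ e e' (n + 1) c := by
  induction n with
  | zero =>
    refine ext_curryLeft fun x => ?_
    simp only [AlternatingMap.curryLeft_add, LinearMap.add_apply, curryLeft_coboundary_zero,
      curryLeft_casimirHomotopy, curryLeft_coboundary, casimirHomotopy_sub,
      lieDeriv_casimirHomotopy ρ he, casimirHomotopy_coboundary_zero, curryLeft_casimir]
    abel
  | succ n ih =>
    refine ext_curryLeft fun x => ?_
    simp only [AlternatingMap.curryLeft_add, LinearMap.add_apply, curryLeft_casimir, ← ih,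
      curryLeft_casimirHomotopy, curryLeft_coboundary, casimirHomotopy_sub, map_neg,
      lieDeriv_casimirHomotopy ρ he]
    abel

end Casimir

/-! ### Positive operators and abstract Hodge theory -/

section LinearAlgebra

variable {C C' : Type*} [AddCommGroup C] [Module ℝ C] [AddCommGroup C'] [Module ℝ C']

/-- A symmetric positive definite bilinear form. -/
structure IsPosDefForm (B : C →ₗ[ℝ] C →ₗ[ℝ] ℝ) : Prop where
  symm : ∀ x y, B x y = B y x
  nonneg : ∀ x, 0 ≤ B x x
  definite : ∀ x, B x x = 0 → x = 0

/-- The operator `∑ₖ Sₖ Tₖ`, thought of as a Laplacian when `Sₖ` is the adjoint of `Tₖ`. -/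
def sumMul {κ : Type*} [Fintype κ] (S T : κ → Module.End ℝ C) : Module.End ℝ C :=
  ∑ k, S k * T k

variable {κ : Type*} [Fintype κ] {B : C →ₗ[ℝ] C →ₗ[ℝ] ℝ} {S T : κ → Module.End ℝ C}

lemma IsPosDefForm.sumMul_apply_left (hST : ∀ k x y, B (S k x) y = B x (T k y)) (x y : C) :
    B (sumMul S T x) y = ∑ k, B (T k x) (T k y) := by
  simp [sumMul, LinearMap.sum_apply, hST]

/-- Pairing `∑ S k (T k x)` with `x` gives `∑ B (T k x) (T k x)`, a sum of nonnegative terms. -/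
lemma IsPosDefForm.sumMul_eq_zero_iff (hB : IsPosDefForm B)
    (hST : ∀ k x y, B (S k x) y = B x (T k y)) (x : C) :
    sumMul S T x = 0 ↔ ∀ k, T k x = 0 := by
  constructor
  · intro h k
    have h1 := sumMul_apply_left hST x x
    rw [h, map_zero, LinearMap.zero_apply] at h1
    exact hB.definite _
      ((Finset.sum_eq_zero_iff_of_nonneg fun k _ => hB.nonneg (T k x)).1 h1.symm k
        (Finset.mem_univ k))
  · intro h
    simp [sumMul, LinearMap.sum_apply, h]

/-- A vector of the range that lies in the kernel is killed by every `T k`, hence orthogonal to the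
range and so to itself. Counting dimensions does the rest. -/
lemma IsPosDefForm.isCompl_sumMul [Module.Finite ℝ C] (hB : IsPosDefForm B)
    (hST : ∀ k x y, B (S k x) y = B x (T k y)) :
    IsCompl (LinearMap.ker (sumMul S T)) (LinearMap.range (sumMul S T)) := by
  have hdisj : Disjoint (LinearMap.ker (sumMul S T)) (LinearMap.range (sumMul S T)) := by
    rw [Submodule.disjoint_def]
    rintro _ h ⟨y, rfl⟩
    refine hB.definite _ ?_
    rw [sumMul_apply_left hST, Finset.sum_eq_zero]
    intro k _
    rw [(hB.sumMul_eq_zero_iff hST _).1 h k, map_zero]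
  refine ⟨hdisj, codisjoint_iff.2 (Submodule.eq_top_of_disjoint _ _ ?_ hdisj)⟩
  rw [add_comm, LinearMap.finrank_range_add_finrank_ker]

lemma linearMap_eq_zero {ι C W : Type*} [AddCommGroup C] [Module ℝ C] [AddCommGroup W] [Module ℝ W]
    {τ : C →ₗ[ℝ] C} {e : Module.Basis ι ℝ C}
    (hsurj : Function.Surjective τ) (f : C →ₗ[ℝ] W) (hf : ∀ i, f (τ (e i)) = 0) : f = 0 := by
  have : f ∘ₗ τ = 0 := e.ext hf
  ext x
  obtain ⟨y, rfl⟩ := hsurj x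
  exact LinearMap.congr_fun this y

/-- Hodge theory for an operator `D` which is null-homotopic on cocycles: the cocycles modulo the
coboundaries are represented by the kernel of `D`. -/
lemma exists_equiv_ker_of_isCompl {D : Module.End ℝ C} {D' : Module.End ℝ C'}
    {d : C →ₗ[ℝ] C'} {b : Submodule ℝ C}
    (hcomm : ∀ x, d (D x) = D' (d x)) (hD : IsCompl (LinearMap.ker D) (LinearMap.range D))
    (hD' : Disjoint (LinearMap.ker D') (LinearMap.range D'))
    (hker : LinearMap.ker D ≤ LinearMap.ker d)
    (hexact : ∀ z, d z = 0 → D z ∈ b) (hb : Disjoint (LinearMap.ker D) b) :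
    Nonempty ((LinearMap.ker d ⧸ b.submoduleOf (LinearMap.ker d)) ≃ₗ[ℝ] LinearMap.ker D) := by
  let f : LinearMap.ker D →ₗ[ℝ] (LinearMap.ker d ⧸ b.submoduleOf (LinearMap.ker d)) :=
    (b.submoduleOf (LinearMap.ker d)).mkQ ∘ₗ Submodule.inclusion hker
  have hinj : Function.Injective f := by
    rw [← LinearMap.ker_eq_bot, LinearMap.ker_eq_bot']
    rintro ⟨x, hx⟩ h
    have h' : x ∈ b := (Submodule.Quotient.mk_eq_zero (b.submoduleOf (LinearMap.ker d))
      (x := Submodule.inclusion hker ⟨x, hx⟩)).1 h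
    exact Subtype.ext ((Submodule.disjoint_def.1 hb) x hx h')
  have hsurj : Function.Surjective f := by
    intro q
    obtain ⟨⟨z, hz⟩, rfl⟩ := Submodule.Quotient.mk_surjective _ q
    have decomp : ∀ x : C, ∃ n ∈ LinearMap.ker D, ∃ y, n + D y = x := by
      intro x
      obtain ⟨n, hn, _, ⟨y, rfl⟩, h⟩ := Submodule.mem_sup.1 (hD.sup_eq_top ▸ Submodule.mem_top (x := x))
      exact ⟨n, hn, y, h⟩
    -- The cocycle is `n + D y`. Splitting `y` once more shows that `y` is itself a cocycle, so that
    -- `D y` lies in `b` by `hexact`.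
    obtain ⟨n, hn, y, rfl⟩ := decomp z
    obtain ⟨n', hn', y', rfl⟩ := decomp y
    have hdn : d n = 0 := hker hn
    have hdn' : d n' = 0 := hker hn'
    have hz' : d (n + D (n' + D y')) = 0 := hz
    -- This vector is killed by `D'` because `z` and `n` are cocycles, and it equals `D' (d y')`
    -- because `n'` is one.
    have hy : d (n' + D y') = 0 := by
      refine Submodule.disjoint_def.1 hD' _ ?_ ?_
      · rw [LinearMap.mem_ker, ← hcomm]
        rwa [map_add, hdn, zero_add] at hz'
      · rw [map_add, hdn', zero_add, hcomm]
        exact ⟨_, rfl⟩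
    refine ⟨⟨n, hn⟩, (Submodule.Quotient.eq _).2 ?_⟩
    change n - (n + D (n' + D y')) ∈ b
    rw [sub_add_cancel_left]
    exact b.neg_mem (hexact _ hy)
  exact ⟨(LinearEquiv.ofBijective f ⟨hinj, hsurj⟩).symm⟩

end LinearAlgebra

/-! ### The Laplacian on cochains and its kernel -/

section Cochains

variable {L V ι : Type*} [LieRing L] [LieAlgebra ℝ L] [AddCommGroup V] [Module ℝ V] [Fintype ι]

instance finite_alternatingMap [Module.Finite ℝ L] [Module.Finite ℝ V] (n : ℕ) :
    Module.Finite ℝ (L [⋀^Fin n]→ₗ[ℝ] V) :=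
  Module.Finite.of_injective
    (AlternatingMap.toMultilinearMapLM (R := ℝ) (S := ℝ) (M := L) (N := V) (ι := Fin n))
    AlternatingMap.coe_multilinearMap_injective

lemma alternatingMap_sum_apply {κ W : Type*} [AddCommGroup W] [Module ℝ W] (s : Finset κ) {n : ℕ}
    (c : κ → W [⋀^Fin n]→ₗ[ℝ] V) (v : Fin n → W) : (∑ k ∈ s, c k) v = ∑ k ∈ s, c k v := by
  induction s using Finset.cons_induction with
  | empty => simp
  | cons k s hk ih => rw [Finset.sum_cons, Finset.sum_cons, AlternatingMap.add_apply, ih]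

/-- The bilinear form on cochains defined by a basis of `L` and a bilinear form on `V`. -/
noncomputable def cochainForm (e : Module.Basis ι ℝ L) (B : V →ₗ[ℝ] V →ₗ[ℝ] ℝ) (n : ℕ) :
    (L [⋀^Fin n]→ₗ[ℝ] V) →ₗ[ℝ] (L [⋀^Fin n]→ₗ[ℝ] V) →ₗ[ℝ] ℝ :=
  LinearMap.mk₂ ℝ (fun c c' => ∑ f : Fin n → ι, B (c (e ∘ f)) (c' (e ∘ f)))
    (fun _ _ _ => by simp [Finset.sum_add_distrib])
    (fun _ _ _ => by simp [Finset.mul_sum])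
    (fun _ _ _ => by simp [Finset.sum_add_distrib])
    (fun _ _ _ => by simp [Finset.mul_sum])

lemma cochainForm_apply (e : Module.Basis ι ℝ L) (B : V →ₗ[ℝ] V →ₗ[ℝ] ℝ) {n : ℕ}
    (c c' : L [⋀^Fin n]→ₗ[ℝ] V) :
    cochainForm e B n c c' = ∑ f : Fin n → ι, B (c (e ∘ f)) (c' (e ∘ f)) := rfl

lemma isPosDefForm_cochainForm (e : Module.Basis ι ℝ L) {B : V →ₗ[ℝ] V →ₗ[ℝ] ℝ}
    (hB : IsPosDefForm B) (n : ℕ) : IsPosDefForm (cochainForm e B n) where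
  symm c c' := Finset.sum_congr rfl fun f _ => hB.symm _ _
  nonneg c := Finset.sum_nonneg fun f _ => hB.nonneg _
  definite c h := by
    have h' := (Finset.sum_eq_zero_iff_of_nonneg fun f _ => hB.nonneg (c (e ∘ f))).1 h
    refine Module.Basis.ext_alternating e fun f _ => ?_
    exact hB.definite _ (h' f (Finset.mem_univ f))

/-- Exchanging the `k`-th value of a function with a further value. -/
def exchange {n : ℕ} (k : Fin n) : Equiv.Perm ((Fin n → ι) × ι) :=
  Function.Involutive.toPerm (fun p => (Function.update p.1 k p.2, p.1 k)) fun p => by simp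

/-- For each slot `k`, both sides expand into sums over the labels `f` and a new label for slot `k`.
Exchanging the new label with `f k` transposes the matrix entry. -/
lemma cochainForm_derivAction (e : Module.Basis ι ℝ L) (B : V →ₗ[ℝ] V →ₗ[ℝ] ℝ)
    {S S' : L →ₗ[ℝ] L} (hS : ∀ i j, e.repr (S (e j)) i = e.repr (S' (e i)) j) {n : ℕ}
    (c c' : L [⋀^Fin n]→ₗ[ℝ] V) :
    cochainForm e B n (derivAction S c) c' = cochainForm e B n c (derivAction S' c') := by
  simp only [cochainForm_apply, derivAction_apply, map_sum, LinearMap.sum_apply]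
  rw [Finset.sum_comm, Finset.sum_comm (s := Finset.univ (α := Fin n → ι))]
  refine Finset.sum_congr rfl fun k _ => ?_
  have expand : ∀ (A : L →ₗ[ℝ] L) (w : L [⋀^Fin n]→ₗ[ℝ] V) (f : Fin n → ι),
      w (Function.update (e ∘ f) k (A ((e ∘ f) k))) =
        ∑ l, e.repr (A (e (f k))) l • w (e ∘ Function.update f k l) := by
    intro A w f
    conv_lhs => rw [← e.sum_repr (A ((e ∘ f) k))]
    rw [AlternatingMap.map_update_sum]
    refine Finset.sum_congr rfl fun l _ => ?_
    rw [AlternatingMap.map_update_smul, Function.comp_update]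
    rfl
  simp only [expand, map_sum, LinearMap.sum_apply, map_smul, LinearMap.smul_apply]
  rw [← Fintype.sum_prod_type', ← Fintype.sum_prod_type', ← Equiv.sum_comp (exchange k)]
  refine Finset.sum_congr rfl fun p _ => ?_
  simp [exchange, Function.Involutive.toPerm, hS]

/-- A bilinear form for which `ρ(τ x)` is the adjoint of `ρ(x)`. -/
def IsContragredient (ρ : L →ₗ⁅ℝ⁆ Module.End ℝ V) (τ : L →ₗ[ℝ] L) (B : V →ₗ[ℝ] V →ₗ[ℝ] ℝ) :
    Prop :=
  ∀ x u w, B (ρ x u) w = B u (ρ (τ x) w)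

variable (ρ : L →ₗ⁅ℝ⁆ Module.End ℝ V) {τ : L →ₗ[ℝ] L} {B : V →ₗ[ℝ] V →ₗ[ℝ] ℝ}
  {e : Module.Basis ι ℝ L}

lemma cochainForm_compAlternatingMap (hρ : IsContragredient ρ τ B) {n : ℕ} (x : L)
    (c c' : L [⋀^Fin n]→ₗ[ℝ] V) :
    cochainForm e B n ((ρ x).compAlternatingMap c) c' =
      cochainForm e B n c ((ρ (τ x)).compAlternatingMap c') := by
  simp only [cochainForm_apply, LinearMap.compAlternatingMap_apply, hρ x]

lemma cochainForm_lieDeriv (hρ : IsContragredient ρ τ B)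
    (hτ : ∀ x i j, e.repr ⁅x, e j⁆ i = e.repr ⁅τ x, e i⁆ j) {n : ℕ} (x : L)
    (c c' : L [⋀^Fin n]→ₗ[ℝ] V) :
    cochainForm e B n (lieDeriv ρ n x c) c' = cochainForm e B n c (lieDeriv ρ n (τ x) c') := by
  change cochainForm e B n ((ρ x).compAlternatingMap c - derivAction (LieAlgebra.ad ℝ L x) c) c' =
    cochainForm e B n c
      ((ρ (τ x)).compAlternatingMap c' - derivAction (LieAlgebra.ad ℝ L (τ x)) c')
  rw [map_sub, map_sub, LinearMap.sub_apply, cochainForm_compAlternatingMap ρ hρ,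
    cochainForm_derivAction e B (S := LieAlgebra.ad ℝ L x) (S' := LieAlgebra.ad ℝ L (τ x))]
  intro i j
  simpa using hτ x i j

/-- Post-composition with `ρ(x)`, as an endomorphism of the space of cochains. -/
def valueAction (n : ℕ) (x : L) : Module.End ℝ (L [⋀^Fin n]→ₗ[ℝ] V) :=
  LinearMap.compAlternatingMapₗ ℝ (ρ x)

variable (τ e) in
/-- The Laplacian `∑ᵢ θ(eᵢ) θ(τ eᵢ) + ∑ᵢ ρ(eᵢ) ρ(τ eᵢ)` on cochains. -/
noncomputable def laplacian (n : ℕ) : Module.End ℝ (L [⋀^Fin n]→ₗ[ℝ] V) :=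
  sumMul (Sum.elim (fun i => lieDeriv ρ n (e i)) fun i => valueAction ρ n (e i))
    (Sum.elim (fun i => lieDeriv ρ n (τ (e i))) fun i => valueAction ρ n (τ (e i)))

lemma laplacian_apply {n : ℕ} (c : L [⋀^Fin n]→ₗ[ℝ] V) :
    laplacian ρ τ e n c = (∑ i, lieDeriv ρ n (e i) (lieDeriv ρ n (τ (e i)) c)) +
      casimir ρ e (fun i => τ (e i)) n c := by
  simp [laplacian, sumMul, LinearMap.sum_apply]
  rfl

lemma laplacian_adjoint (hρ : IsContragredient ρ τ B)
    (hτ : ∀ x i j, e.repr ⁅x, e j⁆ i = e.repr ⁅τ x, e i⁆ j) (n : ℕ) (k : ι ⊕ ι)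
    (c c' : L [⋀^Fin n]→ₗ[ℝ] V) :
    cochainForm e B n
        (Sum.elim (fun i => lieDeriv ρ n (e i)) (fun i => valueAction ρ n (e i)) k c) c' =
      cochainForm e B n c
        (Sum.elim (fun i => lieDeriv ρ n (τ (e i))) (fun i => valueAction ρ n (τ (e i))) k c') := by
  cases k with
  | inl i => exact cochainForm_lieDeriv ρ hρ hτ _ _ _
  | inr i => exact cochainForm_compAlternatingMap ρ hρ _ _ _

/-- The cochains with values in the invariants of `V`, which are invariant under the adjoint
action. -/
def invariantCochains (n : ℕ) : Submodule ℝ (L [⋀^Fin n]→ₗ[ℝ] V) where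
  carrier := {c | ∀ x v, ρ x (c v) = 0 ∧ ∑ i, c (Function.update v i ⁅x, v i⁆) = 0}
  add_mem' h h' x v := by
    simp only [AlternatingMap.add_apply, map_add, Finset.sum_add_distrib, (h x v).1, (h' x v).1,
      (h x v).2, (h' x v).2, add_zero, and_self]
  zero_mem' x v := by simp
  smul_mem' r c h x v := by
    simp only [AlternatingMap.smul_apply, map_smul, ← Finset.smul_sum, (h x v).1, (h x v).2,
      smul_zero, and_self]

/-- The terms with `ρ` vanish since the values are invariant. Twice the bracket part is, by
`two_smul_bracket_sum`, a signed sum of adjoint actions on `c`, each of which is zero. -/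
lemma coboundary_eq_zero_of_mem_invariantCochains {n : ℕ} {c : L [⋀^Fin n]→ₗ[ℝ] V}
    (hc : c ∈ invariantCochains ρ n) : coboundary ρ n c = 0 := by
  ext v
  have h := two_smul_bracket_sum c v
  have h0 : ∀ j : Fin (n + 1), ∑ i : Fin n,
      c (Function.update (j.removeNth v) i ⁅j.removeNth v i, v j⁆) = 0 := by
    intro j
    rw [← neg_eq_zero, ← Finset.sum_neg_distrib, ← (hc (v j) (j.removeNth v)).2]
    refine Finset.sum_congr rfl fun i _ => ?_
    rw [← lie_skew, AlternatingMap.map_update_neg]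
    simp
  simp only [h0, smul_zero, Finset.sum_const_zero] at h
  rw [coboundary_apply, coboundaryFun, (smul_eq_zero.1 h.symm).resolve_left two_ne_zero, add_zero]
  exact Finset.sum_eq_zero fun j _ => by rw [(hc (v j) _).1, smul_zero]

/-- The Casimir half makes the values of `c` invariant; then `θ_x c = 0` reduces to invariance under
the adjoint action alone. Without that half the kernel would only consist of equivariant cochains.
-/
lemma ker_laplacian (hB : IsPosDefForm B) (hρ : IsContragredient ρ τ B)
    (hτ : ∀ x i j, e.repr ⁅x, e j⁆ i = e.repr ⁅τ x, e i⁆ j) (hsurj : Function.Surjective τ)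
    (n : ℕ) : LinearMap.ker (laplacian ρ τ e n) = invariantCochains ρ n := by
  ext c
  rw [LinearMap.mem_ker, laplacian,
    (isPosDefForm_cochainForm e hB n).sumMul_eq_zero_iff (laplacian_adjoint ρ hρ hτ n)]
  constructor
  · intro h x v
    have h1 : ∀ x, lieDeriv ρ n x c = 0 := fun x => LinearMap.congr_fun
      (linearMap_eq_zero hsurj ((LinearMap.applyₗ c) ∘ₗ lieDeriv ρ n) fun i => h (Sum.inl i)) x
    have h2 : ∀ x, ρ x (c v) = 0 := fun x => LinearMap.congr_fun
      (linearMap_eq_zero hsurj ((LinearMap.applyₗ (c v)) ∘ₗ (ρ : L →ₗ[ℝ] Module.End ℝ V)) fun i =>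
        congrArg (fun g => g v) (h (Sum.inr i))) x
    refine ⟨h2 x, ?_⟩
    have := congrArg (fun g => g v) (h1 x)
    simp only [lieDeriv_apply, h2, zero_sub, AlternatingMap.zero_apply, neg_eq_zero] at this
    exact this
  · rintro h (i | i)
    · ext v
      simp [lieDeriv_apply, (h _ v).1, (h _ v).2]
    · ext v
      exact (h _ v).1

/-- As `τ` is an involutive anti-automorphism, the matrix of `ad x` in the vectors `τ (e i)` is
minus the transpose of its matrix in the `e i`, so the two sums cancel. -/
lemma sum_lie_tmul_transpose (hτ : ∀ x i j, e.repr ⁅x, e j⁆ i = e.repr ⁅τ x, e i⁆ j)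
    (hlie : ∀ x y, τ ⁅x, y⁆ = ⁅τ y, τ x⁆) (hinv : ∀ x, τ (τ x) = x) (x : L) :
    ∑ i, (⁅x, e i⁆ ⊗ₜ[ℝ] τ (e i) + e i ⊗ₜ[ℝ] ⁅x, τ (e i)⁆) = 0 := by
  have h1 : ∀ i, ⁅x, τ (e i)⁆ = -∑ j, e.repr ⁅τ x, e i⁆ j • τ (e j) := by
    intro i
    simp_rw [← map_smul, ← map_sum]
    rw [e.sum_repr, hlie, hinv, lie_skew]
  have h2 : ∀ i, ⁅x, e i⁆ = ∑ j, e.repr ⁅τ x, e j⁆ i • e j := by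
    intro i
    conv_lhs => rw [← e.sum_repr ⁅x, e i⁆]
    exact Finset.sum_congr rfl fun j _ => by rw [hτ]
  rw [Finset.sum_add_distrib]
  simp only [h1, h2, TensorProduct.sum_tmul, TensorProduct.tmul_neg, TensorProduct.tmul_sum,
    TensorProduct.smul_tmul, Finset.sum_neg_distrib]
  rw [Finset.sum_comm, add_neg_cancel]

/-- Both sides equal `d h d c`, by the homotopy formula and `d d = 0`. -/
lemma coboundary_casimir {e e' : ι → L}
    (he : ∀ x : L, ∑ i, (⁅x, e i⁆ ⊗ₜ[ℝ] e' i + e i ⊗ₜ[ℝ] ⁅x, e' i⁆) = 0) {n : ℕ}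
    (c : L [⋀^Fin n]→ₗ[ℝ] V) :
    coboundary ρ n (casimir ρ e e' n c) = casimir ρ e e' (n + 1) (coboundary ρ n c) := by
  rw [← coboundary_casimirHomotopy ρ he, coboundary_coboundary]
  cases n with
  | zero => simp [← casimirHomotopy_coboundary_zero, casimirHomotopy, -map_sum]
  | succ n =>
    rw [← coboundary_casimirHomotopy ρ he, map_add, coboundary_coboundary, zero_add]
    simp [casimirHomotopy]

lemma lieDeriv_mem_coboundaries {n : ℕ} (x : L) {c : L [⋀^Fin n]→ₗ[ℝ] V}
    (hc : coboundary ρ n c = 0) : lieDeriv ρ n x c ∈ coboundaries ρ n := by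
  cases n with
  | zero =>
    rw [← curryLeft_coboundary_zero, hc]
    exact Submodule.zero_mem _
  | succ n =>
    have h := curryLeft_coboundary ρ x c
    rw [hc, AlternatingMap.curryLeft_zero, LinearMap.zero_apply, eq_comm, sub_eq_zero] at h
    exact ⟨_, h.symm⟩

lemma casimir_mem_coboundaries {e e' : ι → L}
    (he : ∀ x : L, ∑ i, (⁅x, e i⁆ ⊗ₜ[ℝ] e' i + e i ⊗ₜ[ℝ] ⁅x, e' i⁆) = 0) {n : ℕ}
    {c : L [⋀^Fin n]→ₗ[ℝ] V} (hc : coboundary ρ n c = 0) :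
    casimir ρ e e' n c ∈ coboundaries ρ n := by
  cases n with
  | zero =>
    rw [← casimirHomotopy_coboundary_zero, hc]
    simp [casimirHomotopy]
  | succ n =>
    have h := coboundary_casimirHomotopy ρ he c
    rw [hc] at h
    refine ⟨casimirHomotopy ρ e e' n c, ?_⟩
    rw [← h]
    simp [casimirHomotopy]

/-- The cohomology of a representation with an invariant inner product is represented by the
invariant cochains. -/
theorem exists_cohomology_equiv_invariantCochains [Module.Finite ℝ V] (hB : IsPosDefForm B)
    (hρ : IsContragredient ρ τ B) (hτ : ∀ x i j, e.repr ⁅x, e j⁆ i = e.repr ⁅τ x, e i⁆ j)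
    (hlie : ∀ x y, τ ⁅x, y⁆ = ⁅τ y, τ x⁆) (hinv : ∀ x, τ (τ x) = x) (n : ℕ) :
    Nonempty (Cohomology ρ n ≃ₗ[ℝ] invariantCochains ρ n) := by
  have he := sum_lie_tmul_transpose hτ hlie hinv
  have : Module.Finite ℝ L := Module.Finite.of_basis e
  have hsurj : Function.Surjective τ := fun x => ⟨τ x, hinv x⟩
  have hcompl : ∀ n, IsCompl (LinearMap.ker (laplacian ρ τ e n))
      (LinearMap.range (laplacian ρ τ e n)) := fun n =>
    (isPosDefForm_cochainForm e hB n).isCompl_sumMul (laplacian_adjoint ρ hρ hτ n)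
  have hcomm : ∀ n c, coboundary ρ n (laplacian ρ τ e n c) =
      laplacian ρ τ e (n + 1) (coboundary ρ n c) := by
    intro n c
    simp only [laplacian_apply, map_add, map_sum, coboundary_lieDeriv, coboundary_casimir ρ he]
  have hker : ∀ n, LinearMap.ker (laplacian ρ τ e n) ≤ LinearMap.ker (coboundary ρ n) := by
    intro n c hc
    rw [ker_laplacian ρ hB hρ hτ hsurj] at hc
    exact coboundary_eq_zero_of_mem_invariantCochains ρ hc
  have hexact : ∀ n c, coboundary ρ n c = 0 → laplacian ρ τ e n c ∈ coboundaries ρ n := by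
    intro n c hc
    rw [laplacian_apply]
    refine Submodule.add_mem _ (Submodule.sum_mem _ fun i _ => ?_)
      (casimir_mem_coboundaries ρ he hc)
    refine lieDeriv_mem_coboundaries ρ _ ?_
    rw [coboundary_lieDeriv, hc, map_zero]
  have hb : ∀ n, Disjoint (LinearMap.ker (laplacian ρ τ e n)) (coboundaries ρ n) := by
    intro n
    cases n with
    | zero => exact disjoint_bot_right
    | succ n =>
      rw [Submodule.disjoint_def]
      rintro _ h ⟨u, rfl⟩
      -- Only the part of `u` in the range of the Laplacian contributes to its coboundary, which
      -- therefore lies in the range as well as in the kernel.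
      obtain ⟨w, hw, _, ⟨y, rfl⟩, rfl⟩ :=
        Submodule.mem_sup.1 ((hcompl n).sup_eq_top ▸ Submodule.mem_top (x := u))
      have hw' : coboundary ρ n w = 0 := hker n hw
      refine Submodule.disjoint_def.1 (hcompl (n + 1)).disjoint _ h ?_
      rw [map_add, hw', zero_add, hcomm]
      exact ⟨_, rfl⟩
  rw [← ker_laplacian ρ hB hρ hτ hsurj]
  exact exists_equiv_ker_of_isCompl (hcomm n) (hcompl n) (hcompl (n + 1)).disjoint (hker n)
    (hexact n) (hb n)

/-- Invariant cochains with values in `V` are sums of products of invariant forms and invariants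
of `V`. -/
theorem exists_invariantCochains_equiv_tensorProduct [Module.Finite ℝ V] (n : ℕ) :
    Nonempty (invariantCochains ρ n ≃ₗ[ℝ] (invariantForms L n ⊗[ℝ] invariants ρ)) := by
  let b := Module.finBasis ℝ (invariants ρ)
  let E : invariantCochains ρ n ≃ₗ[ℝ]
      (Fin (Module.finrank ℝ (invariants ρ)) → invariantForms L n) :=
    { toFun := fun c k => ⟨((b.coord k).compAlternatingMap
        (AlternatingMap.codRestrict c.1 (invariants ρ) fun v x => (c.2 x v).1)), fun x v => by
          have h : ∑ i, AlternatingMap.codRestrict c.1 (invariants ρ)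
              (fun v x => (c.2 x v).1) (Function.update v i ⁅x, v i⁆) = 0 := by
            ext
            rw [AddSubmonoidClass.coe_finsetSum]
            exact (c.2 x v).2
          simp only [LinearMap.compAlternatingMap_apply, ← map_sum, h, map_zero]⟩
      map_add' := fun c c' => by
        ext k v
        exact (b.coord k).map_add
          (AlternatingMap.codRestrict c.1 (invariants ρ) (fun v x => (c.2 x v).1) v)
          (AlternatingMap.codRestrict c'.1 (invariants ρ) (fun v x => (c'.2 x v).1) v)
      map_smul' := fun r c => by
        ext k v
        exact (b.coord k).map_smul r
          (AlternatingMap.codRestrict c.1 (invariants ρ) (fun v x => (c.2 x v).1) v)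
      invFun := fun η => ⟨∑ k, (LinearMap.toSpanSingleton ℝ V (b k)).compAlternatingMap (η k).1,
        fun x v => by
          have hv : ∀ v, (∑ k, (LinearMap.toSpanSingleton ℝ V (b k)).compAlternatingMap
              (η k).1) v = ∑ k, (η k).1 v • (b k : V) := by
            intro v
            rw [alternatingMap_sum_apply]
            rfl
          constructor
          · rw [hv, map_sum]
            exact Finset.sum_eq_zero fun k _ => by rw [map_smul, (b k).2 x, smul_zero]
          · simp only [hv]
            rw [Finset.sum_comm]
            exact Finset.sum_eq_zero fun k _ => by
              rw [← Finset.sum_smul, (η k).2 x v, zero_smul]⟩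
      left_inv := fun c => by
        ext v
        change (∑ k, (LinearMap.toSpanSingleton ℝ V (b k)).compAlternatingMap
          ((b.coord k).compAlternatingMap
            (AlternatingMap.codRestrict c.1 (invariants ρ) fun v x => (c.2 x v).1))) v = c.1 v
        rw [alternatingMap_sum_apply]
        have h := congrArg Subtype.val
          (b.sum_repr (AlternatingMap.codRestrict c.1 (invariants ρ) (fun v x => (c.2 x v).1) v))
        rw [AddSubmonoidClass.coe_finsetSum] at h
        exact h
      right_inv := fun η => by
        ext k v
        refine (congrArg (b.coord k) (Subtype.ext ?_ : _ = ∑ k, (η k).1 v • b k)).trans ?_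
        · change (∑ k, (LinearMap.toSpanSingleton ℝ V (b k)).compAlternatingMap (η k).1) v = _
          rw [alternatingMap_sum_apply, AddSubmonoidClass.coe_finsetSum]
          rfl
        · rw [b.coord_apply, b.repr_sum_self] }
  exact ⟨E ≪≫ₗ (TensorProduct.piScalarRight ℝ ℝ _ _).symm ≪≫ₗ
    TensorProduct.congr (LinearEquiv.refl ℝ _) b.equivFun.symm⟩

end Cochains

/-! ### Vanishing through a central element -/

section Central

variable {L V : Type*} [LieRing L] [LieAlgebra ℝ L] [AddCommGroup V] [Module ℝ V]

/-- The cohomology vanishes if a central element acts by a nonzero scalar. -/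
theorem subsingleton_cohomology_of_central (ρ : L →ₗ⁅ℝ⁆ Module.End ℝ V) {z : L}
    (hz : ∀ x : L, ⁅z, x⁆ = 0) {s : ℝ} (hs : s ≠ 0) (hρ : ∀ w, ρ z w = s • w) (n : ℕ) :
    Subsingleton (Cohomology ρ n) := by
  rw [Submodule.Quotient.subsingleton_iff, Submodule.submoduleOf_eq_top]
  intro c hc
  -- The adjoint part of the Lie derivative vanishes because `z` is central.
  have hθ : lieDeriv ρ n z c = s • c := by
    ext v
    simp only [lieDeriv_apply, hz, hρ, AlternatingMap.smul_apply]
    rw [Finset.sum_eq_zero fun i _ => c.map_update_zero v i, sub_zero]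
  have h := lieDeriv_mem_coboundaries ρ z (c := c) hc
  rw [hθ] at h
  exact (Submodule.smul_mem_iff _ hs).1 h

end Central

/-! ### Bases in which `τ` acts as matrix transposition -/

section BasisForm

variable {V W ι κ : Type*} [AddCommGroup V] [Module ℝ V] [AddCommGroup W] [Module ℝ W]

/-- The bilinear form for which a given basis is orthonormal. -/
noncomputable def basisForm [Fintype ι] (b : Module.Basis ι ℝ V) : V →ₗ[ℝ] V →ₗ[ℝ] ℝ :=
  LinearMap.mk₂ ℝ (fun x y => ∑ i, b.repr x i * b.repr y i)
    (fun _ _ _ => by simp [add_mul, Finset.sum_add_distrib])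
    (fun _ _ _ => by simp [Finset.mul_sum, mul_assoc])
    (fun _ _ _ => by simp [mul_add, Finset.sum_add_distrib])
    (fun _ _ _ => by simp [Finset.mul_sum, mul_left_comm])

lemma basisForm_apply [Fintype ι] (b : Module.Basis ι ℝ V) (x y : V) :
    basisForm b x y = ∑ i, b.repr x i * b.repr y i := rfl

lemma isPosDefForm_basisForm [Fintype ι] (b : Module.Basis ι ℝ V) : IsPosDefForm (basisForm b) where
  symm x y := Finset.sum_congr rfl fun i _ => mul_comm _ _
  nonneg x := Finset.sum_nonneg fun i _ => mul_self_nonneg _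
  definite x h := by
    have h' := (Finset.sum_eq_zero_iff_of_nonneg fun i _ => mul_self_nonneg (b.repr x i)).1 h
    exact b.ext_elem fun i => by simpa using h' i (Finset.mem_univ i)

lemma basisForm_adjoint [Fintype ι] [DecidableEq ι] (b : Module.Basis ι ℝ V) {S S' : Module.End ℝ V}
    (h : ∀ i j, b.repr (S (b j)) i = b.repr (S' (b i)) j) (x y : V) :
    basisForm b (S x) y = basisForm b x (S' y) := by
  suffices h' : (basisForm b).compl₁₂ S LinearMap.id = (basisForm b).compl₁₂ LinearMap.id S' from
    LinearMap.congr_fun (LinearMap.congr_fun h' x) y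
  refine b.ext fun i => b.ext fun j => ?_
  simp [basisForm_apply, Finsupp.single_apply, h]

variable {L : Type*} [LieRing L] [LieAlgebra ℝ L]

/-- `ρ(τ x)` is given, in the basis `b`, by the transpose of the matrix of `ρ(x)`. -/
def IsTransposeBasis (ρ : L →ₗ⁅ℝ⁆ Module.End ℝ V) (τ : L →ₗ[ℝ] L) (b : Module.Basis ι ℝ V) :
    Prop :=
  ∀ x i j, b.repr (ρ x (b j)) i = b.repr (ρ (τ x) (b i)) j

variable {ρ : L →ₗ⁅ℝ⁆ Module.End ℝ V} {σ : L →ₗ⁅ℝ⁆ Module.End ℝ W} {τ : L →ₗ[ℝ] L}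
  {b : Module.Basis ι ℝ V} {b' : Module.Basis κ ℝ W}

lemma IsTransposeBasis.isContragredient [Fintype ι] [DecidableEq ι] (h : IsTransposeBasis ρ τ b) :
    IsContragredient ρ τ (basisForm b) :=
  fun x u w => basisForm_adjoint b (h x) u w

lemma IsTransposeBasis.dualRep [Finite ι] [DecidableEq ι] (h : IsTransposeBasis ρ τ b) :
    IsTransposeBasis (dualRep ρ) τ b.dualBasis := by
  intro x i j
  simp [CE.dualRep, h x j i]

lemma IsTransposeBasis.tensorRep [DecidableEq ι] [DecidableEq κ] (h : IsTransposeBasis ρ τ b)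
    (h' : IsTransposeBasis σ τ b') :
    IsTransposeBasis (tensorRep ρ σ) τ (b.tensorProduct b') := by
  rintro x ⟨i, k⟩ ⟨j, l⟩
  simp [CE.tensorRep, h x i j, h' x k l, Finsupp.single_apply, eq_comm]

lemma tensorPowMap_tprod {n : ℕ} (F : Fin n → Module.End ℝ V) (v : Fin n → V) :
    tensorPowMap n F (PiTensorProduct.tprod ℝ v : ⨂[ℝ] _ : Fin n, V) =
      (PiTensorProduct.tprod ℝ fun i => F i (v i) : ⨂[ℝ] _ : Fin n, V) :=
  PiTensorProduct.map_tprod _ _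

/-- The basis of a tensor power defined by a basis. -/
noncomputable def tensorPowBasis (b : Module.Basis ι ℝ V) (n : ℕ) :
    Module.Basis (Fin n → ι) ℝ (TensorPow V n) :=
  Basis.piTensorProduct fun _ : Fin n => b

lemma tensorPowBasis_repr_tensorPowMap (b : Module.Basis ι ℝ V) {n : ℕ}
    (F : Fin n → Module.End ℝ V) (f g : Fin n → ι) :
    (tensorPowBasis b n).repr (tensorPowMap n F (tensorPowBasis b n f)) g =
      ∏ i, b.repr (F i (b (f i))) (g i) := by
  have h : tensorPowBasis b n f =
      (PiTensorProduct.tprod ℝ fun i => b (f i) : ⨂[ℝ] _ : Fin n, V) :=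
    Basis.piTensorProduct_apply _ _
  rw [h, tensorPowMap_tprod]
  exact Basis.piTensorProduct_repr_tprod_apply _ _ _

/-- The matrix entries are products over the slots: slot `k` carries an entry of `ρ x`, which is
transposed by `h`, and the others carry Kronecker deltas, which are symmetric. -/
lemma IsTransposeBasis.tensorPowerRep [DecidableEq ι] (h : IsTransposeBasis ρ τ b) (n : ℕ) :
    IsTransposeBasis (tensorPowerRep ρ n) τ (tensorPowBasis b n) := by
  intro x g f
  simp only [CE.tensorPowerRep, LieHom.coe_mk, LinearMap.sum_apply, map_sum, Finsupp.coe_finsetSum,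
    Finset.sum_apply, tensorPowBasis_repr_tensorPowMap]
  refine Finset.sum_congr rfl fun k _ => Finset.prod_congr rfl fun i _ => ?_
  by_cases hi : i = k
  · subst hi
    simpa using h x _ _
  · simp [Function.update_of_ne hi, Finsupp.single_apply, eq_comm]

end BasisForm

/-! ### Scalars, traces and transposes for `gl(m, ℝ)` -/

section General

variable {V : Type*} [AddCommGroup V] [Module ℝ V] {m : ℕ}

lemma isTransposeBasis_vectorRep (m : ℕ) :
    IsTransposeBasis (vectorRep m) (Matrix.transposeLinearEquiv (Fin m) (Fin m) ℝ ℝ).toLinearMap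
      (Pi.basisFun ℝ (Fin m)) := by
  intro x i j
  simp [vectorRep]

/-- The elementary matrices are orthonormal for `tr (Xᵀ Y)`, and for this form the adjoint of `ad x`
is `ad xᵀ`. -/
lemma stdBasis_repr_lie (x : Matrix (Fin m) (Fin m) ℝ) (i j : Fin m × Fin m) :
    (Matrix.stdBasis ℝ (Fin m) (Fin m)).repr ⁅x, Matrix.stdBasis ℝ (Fin m) (Fin m) j⁆ i =
      (Matrix.stdBasis ℝ (Fin m) (Fin m)).repr
        ⁅x.transpose, Matrix.stdBasis ℝ (Fin m) (Fin m) i⁆ j := by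
  have hr : ∀ (y : Matrix (Fin m) (Fin m) ℝ) (i : Fin m × Fin m),
      (Matrix.stdBasis ℝ (Fin m) (Fin m)).repr y i = y i.1 i.2 := fun y i => rfl
  obtain ⟨p, q⟩ := i
  obtain ⟨k, l⟩ := j
  simp only [hr, Matrix.stdBasis_eq_single, Ring.lie_def, Matrix.sub_apply, Matrix.mul_apply,
    Matrix.single_apply, ite_and, Matrix.transpose_apply]
  simp [eq_comm]

lemma tensorPowerRep_apply_of_scalar {L : Type*} [LieRing L] [LieAlgebra ℝ L]
    (ρ : L →ₗ⁅ℝ⁆ Module.End ℝ V) {x : L} {s : ℝ} (hx : ρ x = s • 1) (n : ℕ) :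
    tensorPowerRep ρ n x = (n * s) • 1 := by
  change ∑ i : Fin n, tensorPowMap n (Function.update 1 i (ρ x)) = _
  have h : ∀ i : Fin n, tensorPowMap (V := V) n (Function.update 1 i (s • 1)) = s • 1 := by
    intro i
    rw [tensorPowMap_update_smul]
    have h1 : Function.update (1 : Fin n → Module.End ℝ V) i 1 = 1 := Function.update_eq_self i 1
    rw [h1, map_one]
  simp only [hx, h, Finset.sum_const, Finset.card_univ, Fintype.card_fin]
  rw [← Nat.cast_smul_eq_nsmul ℝ, smul_smul]

lemma naturalRep_one (m a b : ℕ) : naturalRep m a b 1 = ((a : ℝ) - b) • 1 := by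
  have h1 : vectorRep m 1 = (1 : ℝ) • 1 := by
    ext; simp [vectorRep]
  have h2 : dualRep (vectorRep m) 1 = (-1 : ℝ) • 1 := by
    ext; simp [dualRep, h1]
  change (tensorPowerRep (vectorRep m) a 1).rTensor _ +
    (tensorPowerRep (dualRep (vectorRep m)) b 1).lTensor _ = _
  rw [tensorPowerRep_apply_of_scalar _ h1, tensorPowerRep_apply_of_scalar _ h2]
  ext x y
  simp [TensorProduct.smul_tmul', sub_eq_add_neg, add_smul]

lemma twist_apply (ρ : Matrix (Fin m) (Fin m) ℝ →ₗ⁅ℝ⁆ Module.End ℝ V) (lam : ℝ)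
    (A : Matrix (Fin m) (Fin m) ℝ) (w : V) :
    twist ρ lam A w = ρ A w - (lam * A.trace) • w := rfl

/-- Any `A` is a traceless matrix plus `tr A / m` times the identity; for `lam = s / m` the twist
cancels the action of the scalar part. -/
lemma invariants_twist (ρ : Matrix (Fin m) (Fin m) ℝ →ₗ⁅ℝ⁆ Module.End ℝ V) {lam s : ℝ}
    (hm : m ≠ 0) (hs : ∀ w, ρ 1 w = s • w) (hlam : lam = s / m) :
    invariants (twist ρ lam) = invariants (restrictSl ρ) := by
  have hm' : (m : ℝ) ≠ 0 := Nat.cast_ne_zero.2 hm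
  ext w
  constructor
  · intro h A
    have h1 : ρ A.1 w - (lam * A.1.trace) • w = 0 := h A.1
    have h2 : A.1.trace = 0 := A.2
    rw [h2, mul_zero, zero_smul, sub_zero] at h1
    exact h1
  · intro h A
    have hA : A - (A.trace / m) • (1 : Matrix (Fin m) (Fin m) ℝ) ∈
        LieAlgebra.SpecialLinear.sl (Fin m) ℝ := by
      change Matrix.trace (A - (A.trace / m) • (1 : Matrix (Fin m) (Fin m) ℝ)) = 0
      rw [Matrix.trace_sub, Matrix.trace_smul, Matrix.trace_one, Fintype.card_fin, smul_eq_mul,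
        div_mul_cancel₀ _ hm', sub_self]
    have h1 : ρ (A - (A.trace / m) • (1 : Matrix (Fin m) (Fin m) ℝ)) w = 0 := h ⟨_, hA⟩
    rw [map_sub, map_smul, LinearMap.sub_apply, LinearMap.smul_apply, hs, smul_smul] at h1
    rw [twist_apply, ← h1, hlam]
    congr 2
    ring

lemma IsPosDefForm.restrict {B : V →ₗ[ℝ] V →ₗ[ℝ] ℝ} (hB : IsPosDefForm B) (U : Submodule ℝ V) :
    IsPosDefForm (B.domRestrict₁₂ U U) where
  symm _ _ := hB.symm _ _
  nonneg _ := hB.nonneg _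
  definite _ h := Subtype.ext (hB.definite _ h)

lemma IsContragredient.subRep {L : Type*} [LieRing L] [LieAlgebra ℝ L]
    {ρ : L →ₗ⁅ℝ⁆ Module.End ℝ V} {τ : L →ₗ[ℝ] L} {B : V →ₗ[ℝ] V →ₗ[ℝ] ℝ}
    (h : IsContragredient ρ τ B) (U : Submodule ℝ V) (hU : ∀ x, ∀ u ∈ U, ρ x u ∈ U) :
    IsContragredient (subRep ρ U hU) τ (B.domRestrict₁₂ U U) :=
  fun x u w => h x u w

lemma IsContragredient.twist {ρ : Matrix (Fin m) (Fin m) ℝ →ₗ⁅ℝ⁆ Module.End ℝ V}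
    {B : V →ₗ[ℝ] V →ₗ[ℝ] ℝ}
    (h : IsContragredient ρ (Matrix.transposeLinearEquiv (Fin m) (Fin m) ℝ ℝ).toLinearMap B)
    (lam : ℝ) :
    IsContragredient (twist ρ lam)
      (Matrix.transposeLinearEquiv (Fin m) (Fin m) ℝ ℝ).toLinearMap B := by
  intro x u w
  simp [twist_apply, h x]

end General

end CE

/-! ### The two cases of the theorem -/

theorem proposition4p3 (m a b : ℕ) (hm : 1 ≤ m)
    (V : Submodule ℝ (CE.TensorSpace m a b))
    (hV : ∀ A, ∀ T ∈ V, CE.naturalRep m a b A T ∈ V) (lam : ℝ) :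
    (lam ≠ ((a : ℝ) - b) / m →
      ∀ p : ℕ, Subsingleton
        (CE.Cohomology (CE.twist (CE.subRep (CE.naturalRep m a b) V hV) lam) p)) ∧
    (lam = ((a : ℝ) - b) / m →
      ∀ p : ℕ, Nonempty
        (CE.Cohomology (CE.twist (CE.subRep (CE.naturalRep m a b) V hV) lam) p ≃ₗ[ℝ]
          (CE.invariantForms (Matrix (Fin m) (Fin m) ℝ) p ⊗[ℝ]
            CE.invariants (CE.restrictSl (CE.subRep (CE.naturalRep m a b) V hV))))) := by
  have hm' : (m : ℝ) ≠ 0 := Nat.cast_ne_zero.2 (by omega)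
  have hone : ∀ w, CE.subRep (CE.naturalRep m a b) V hV 1 w = ((a : ℝ) - b) • w := fun w =>
    Subtype.ext (LinearMap.congr_fun (CE.naturalRep_one m a b) w.1)
  constructor
  · intro hlam p
    refine CE.subsingleton_cohomology_of_central _ (z := 1) (s := (a : ℝ) - b - lam * m)
      (fun x => by simp [Ring.lie_def]) ?_ ?_ p
    · intro h
      exact hlam ((eq_div_iff hm').2 (sub_eq_zero.1 h).symm)
    · intro w
      rw [CE.twist_apply, hone, Matrix.trace_one, Fintype.card_fin, sub_smul]
  · intro hlam p
    -- Transposition passes from the vector representation to duals, tensor powers and tensor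
    -- products, so the product basis of the tensor space yields the required inner product.
    have hbasis := ((CE.isTransposeBasis_vectorRep m).tensorPowerRep a).tensorRep
      ((CE.isTransposeBasis_vectorRep m).dualRep.tensorPowerRep b)
    have : Module.Finite ℝ (CE.TensorSpace m a b) := Module.Finite.of_basis
      ((CE.tensorPowBasis (Pi.basisFun ℝ (Fin m)) a).tensorProduct
        (CE.tensorPowBasis (Pi.basisFun ℝ (Fin m)).dualBasis b))
    obtain ⟨E⟩ := CE.exists_cohomology_equiv_invariantCochains
      (CE.twist (CE.subRep (CE.naturalRep m a b) V hV) lam)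
      (e := Matrix.stdBasis ℝ (Fin m) (Fin m))
      ((CE.isPosDefForm_basisForm _).restrict V) ((hbasis.isContragredient.subRep V hV).twist lam)
      (fun x i j => CE.stdBasis_repr_lie x i j)
      (fun x y => by simp [Ring.lie_def]) (fun x => by simp) p
    obtain ⟨F⟩ := CE.exists_invariantCochains_equiv_tensorProduct
      (CE.twist (CE.subRep (CE.naturalRep m a b) V hV) lam) p
    rw [CE.invariants_twist _ (by omega) hone hlam] at F
    exact ⟨E ≪≫ₗ F⟩
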